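/- All groups are finite. For a group $G$ let $\mathrm{Irr}(G)$ be the set of its irreducible complex characters, $\mathrm{cd}(G)=\{\chi(1) : \chi\in\mathrm{Irr}(G)\}$, and $\rho(G)$ the set of primes dividing some element of $\mathrm{cd}(G)$. The character degree graph $\Delta(G)$ is the simple graph with vertex set $\rho(G)$ in which two distinct primes $p,q$ are adjacent if and only if $pq$ divides some element of $\mathrm{cd}(G)$. **Theorem.** Let $n\ge 4$ be an even integer and let $G$ be a finite solvable group such that $\Delta(G)$ has exactly $n$ vertices and is $(n-2)$-regular. Let $\Gamma$ be any graph with vertex set $\rho(G)$ obtained from $\Delta(G)$ by adding edges between non-adjacent vertices. Then there is a finite solvable group $H$ such that $\Delta(H)$ is isomorphic to $\Gamma$ as a graph. -/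

import Mathlib

/-- `Irr(G)`: the characters of the irreducible finite-dimensional complex representations
of `G`. (Every finite-dimensional complex vector space has an isomorphic copy in `Type`.) -/
def irreducibleCharacters (G : Type*) [Group G] : Set (G → ℂ) :=
  {χ | ∃ (V : Type) (_ : AddCommGroup V) (_ : Module ℂ V) (_ : FiniteDimensional ℂ V)
      (r : Representation ℂ G V), r.IsIrreducible ∧ r.character = χ}

/-- `cd(G) = {χ(1) | χ ∈ Irr(G)}`, as a set of natural numbers. -/
def characterDegrees (G : Type*) [Group G] : Set ℕ :=
  {d | ∃ χ ∈ irreducibleCharacters G, χ 1 = (d : ℂ)}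

/-- `ρ(G)`: the primes that divide some character degree of `G`. -/
def characterDegreePrimes (G : Type*) [Group G] : Set ℕ :=
  {p | p.Prime ∧ ∃ d ∈ characterDegrees G, p ∣ d}

/-- The character degree graph `Δ(G)`: its vertex set is `ρ(G)`, and two distinct primes `p`, `q`
are adjacent iff `p * q` divides some character degree of `G`. -/
def characterDegreeGraph (G : Type*) [Group G] : SimpleGraph (characterDegreePrimes G) where
  Adj p q := p ≠ q ∧ ∃ d ∈ characterDegrees G, (p : ℕ) * (q : ℕ) ∣ d
  symm := ⟨fun _ _ ⟨hne, d, hd, h⟩ => ⟨hne.symm, d, hd, by rwa [mul_comm]⟩⟩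
  loopless := ⟨fun _ h => h.1 rfl⟩

/-- A graph is a character degree graph of a solvable group if it is isomorphic to `Δ(H)` for some
finite solvable group `H`. -/
def IsSolvableCharacterDegreeGraph {V : Type*} (Γ : SimpleGraph V) : Prop :=
  ∃ (H : Type) (_ : Group H), Finite H ∧ Group.IsSolvable H ∧ Nonempty (characterDegreeGraph H ≃g Γ)

/-!
In an `(n - 2)`-regular graph on `n` vertices every vertex has exactly one non-neighbour besides
itself, so in `Γ` every vertex has at most one. Hence `Γ` is an iterated join of single vertices and
of pairs of non-adjacent vertices. The join of graphs corresponds to the direct product of groups: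
`characterDegrees_prod` says that the degrees of `G₁ × G₂` are the products of a degree of `G₁` and
one of `G₂`, so if the factors have degrees divisible by different primes, their degree graphs are
joined. It therefore suffices to find, with arbitrarily large primes, solvable groups with degrees
`{1, p}` and `{1, p, q}`.

Both are instances of `HeisenbergTorus F C`, the group of matrices `!![1, x, z; 0, c, y; 0, 0, 1]`
with `c` in a subgroup `C` of `Fˣ`, whose degrees are `1`, `|F|` and `|C|`
(`HeisenbergTorus.characterDegrees_eq`): take `F = ZMod p` and `C` trivial, or of prime order `q`
where `p ≡ 1` modulo `q`. An irreducible representation has degree `|F|`, `|C|` or `1`, according to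
whether the centre acts nontrivially, or only the unipotent matrices do, or neither. In each case
there is a vector whose translates by a set of coset representatives have different weights for an
abelian group of operators, and so form a basis.

The degrees of a direct product rest on Burnside's theorem that the operators of an irreducible
representation span all endomorphisms, obtained here from the Jacobson density theorem. The
bookkeeping of joins is carried by `cliqueProducts`: the group `H` that is constructed has as its
degrees exactly the products of distinct prime labels over the cliques of `Γ`.
-/

open Module
open scoped MonoidAlgebra TensorProduct

/-! ### Irreducible representations and Burnside's theorem -/

section Representations

variable {G : Type*} [Group G] {V : Type*} [AddCommGroup V] [Module ℂ V]

theorem Representation.isIrreducible_iff_forall_submodule (r : Representation ℂ G V) :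
    r.IsIrreducible ↔ Nontrivial V ∧
      ∀ W : Submodule ℂ V, (∀ g, ∀ w ∈ W, r g w ∈ W) → W = ⊥ ∨ W = ⊤ := by
  constructor
  · intro h
    refine ⟨?_, fun W hW => ?_⟩
    · by_contra hV
      rw [not_nontrivial_iff_subsingleton] at hV
      exact bot_ne_top (α := Subrepresentation r)
        (Subrepresentation.toSubmodule_injective (Subsingleton.elim _ _))
    · rcases h.eq_bot_or_eq_top (⟨W, fun g v hv => hW g v hv⟩ : Subrepresentation r) with h | h
      · exact Or.inl (congrArg Subrepresentation.toSubmodule h)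
      · exact Or.inr (congrArg Subrepresentation.toSubmodule h)
  · rintro ⟨hV, h⟩
    refine { exists_pair_ne := ⟨⊥, ⊤, fun h => ?_⟩, eq_bot_or_eq_top := fun W => ?_ }
    · exact bot_ne_top (α := Submodule ℂ V) (congrArg Subrepresentation.toSubmodule h)
    · exact (h W.toSubmodule fun g w hw => W.apply_mem_toSubmodule g hw).imp
        (fun h => Subrepresentation.toSubmodule_injective h)
        (fun h => Subrepresentation.toSubmodule_injective h)

theorem mem_characterDegrees {G : Type*} [Group G] {d : ℕ} :
    d ∈ characterDegrees G ↔
      ∃ (V : Type) (_ : AddCommGroup V) (_ : Module ℂ V) (_ : FiniteDimensional ℂ V)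
        (r : Representation ℂ G V), r.IsIrreducible ∧ finrank ℂ V = d := by
  constructor
  · rintro ⟨_, ⟨V, i1, i2, i3, r, hr, rfl⟩, hd⟩
    exact ⟨V, i1, i2, i3, r, hr, by simpa using hd⟩
  · rintro ⟨V, i1, i2, i3, r, hr, hd⟩
    exact ⟨_, ⟨V, i1, i2, i3, r, hr, rfl⟩, by simp [hd]⟩

/-- Every nonzero invariant subspace contains an irreducible subrepresentation. -/
theorem Representation.exists_irreducible_le [FiniteDimensional ℂ V] (r : Representation ℂ G V)
    (W : Submodule ℂ V) (hW : ∀ g, ∀ w ∈ W, r g w ∈ W) (hW0 : W ≠ ⊥) :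
    ∃ U : Subrepresentation r, U.toSubmodule ≤ W ∧ U.toRepresentation.IsIrreducible := by
  obtain ⟨U, ⟨hUW, hU0, hU⟩, hmin⟩ := wellFounded_lt.has_min
    {U : Submodule ℂ V | U ≤ W ∧ U ≠ ⊥ ∧ ∀ g, ∀ w ∈ U, r g w ∈ U} ⟨W, le_rfl, hW0, hW⟩
  refine ⟨⟨U, fun g v hv => hU g v hv⟩, hUW, ?_⟩
  rw [Representation.isIrreducible_iff_forall_submodule]
  refine ⟨Submodule.nontrivial_iff_ne_bot.2 hU0, fun X hX => ?_⟩
  by_cases hX0 : X = ⊥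
  · exact Or.inl hX0
  right
  have hle : X.map U.subtype ≤ U := Submodule.map_subtype_le U X
  have h1 : ¬ X.map U.subtype < U := hmin _ ⟨hle.trans hUW, fun h => hX0
    (Submodule.map_injective_of_injective U.injective_subtype (by rw [h, Submodule.map_bot])), by
    rintro g _ ⟨x, hx, rfl⟩
    exact ⟨_, hX g x hx, rfl⟩⟩
  have h2 : X.map U.subtype = U := eq_of_le_of_not_lt hle h1
  rw [eq_top_iff]
  rintro x -
  obtain ⟨y, hy, hyx⟩ := h2.ge x.2
  rwa [← Subtype.ext hyx]

/-- Burnside's theorem: the operators of an irreducible complex representation span all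
endomorphisms. -/
theorem Representation.IsIrreducible.span_range_eq_top [FiniteDimensional ℂ V]
    {r : Representation ℂ G V} (hr : r.IsIrreducible) :
    Submodule.span ℂ (Set.range r) = (⊤ : Submodule ℂ (End ℂ V)) := by
  have hs : IsSimpleModule ℂ[G] r.asModule :=
    (Representation.irreducible_iff_isSimpleModule_asModule r).1 hr
  classical
  have hmem : ∀ a : ℂ[G], r.asAlgebraHom a ∈ Submodule.span ℂ (Set.range r) := fun a => by
    induction a using MonoidAlgebra.induction_linear with
    | zero => simp
    | add x y hx hy => rw [map_add]; exact Submodule.add_mem _ hx hy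
    | single g c =>
      rw [Representation.asAlgebraHom_single]
      exact Submodule.smul_mem _ _ (Submodule.subset_span ⟨g, rfl⟩)
  rw [eq_top_iff]
  rintro f -
  have : FiniteDimensional ℂ r.asModule := inferInstanceAs (FiniteDimensional ℂ V)
  -- By Schur's lemma the commutant consists of scalars, so `f` is linear over the commutant.
  let F : End (End ℂ[G] r.asModule) r.asModule :=
    { toFun := fun v => r.asModuleEquiv.symm (f (r.asModuleEquiv v))
      map_add' := fun a b => by simp
      map_smul' := fun e v => by
        obtain ⟨c, rfl⟩ := (IsSimpleModule.algebraMap_end_bijective_of_isAlgClosed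
          (A := ℂ[G]) (V := r.asModule) ℂ).2 e
        simp }
  obtain ⟨b⟩ : Nonempty (Basis (Fin (finrank ℂ V)) ℂ V) := ⟨finBasis ℂ V⟩
  obtain ⟨a, ha⟩ := jacobson_density F (Finset.univ.image fun i => r.asModuleEquiv.symm (b i))
  have hfa : f = r.asAlgebraHom a := b.ext fun i => by
    have h := ha (r.asModuleEquiv.symm (b i)) (by simp)
    have h' := congrArg r.asModuleEquiv h
    rw [Representation.asModuleEquiv_map_smul] at h'
    simpa [F] using h'
  exact hfa ▸ hmem a

/-- Converse of Burnside's theorem. -/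
theorem Representation.isIrreducible_of_span_range_eq_top [Nontrivial V]
    {r : Representation ℂ G V}
    (hr : Submodule.span ℂ (Set.range r) = (⊤ : Submodule ℂ (End ℂ V))) : r.IsIrreducible := by
  rw [Representation.isIrreducible_iff_forall_submodule]
  refine ⟨inferInstance, fun W hW => ?_⟩
  by_contra! h
  obtain ⟨w, hw, hw0⟩ := (Submodule.ne_bot_iff W).1 h.1
  apply h.2
  rw [eq_top_iff]
  rintro v -
  have hstab : ∀ f : End ℂ V, f w ∈ W := fun f => by
    have hf : f ∈ Submodule.span ℂ (Set.range r) := hr ▸ Submodule.mem_top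
    induction hf using Submodule.span_induction with
    | mem f hf => obtain ⟨g, rfl⟩ := hf; exact hW g w hw
    | zero => exact W.zero_mem
    | add a b _ _ ha hb => exact W.add_mem ha hb
    | smul c a _ ha => exact W.smul_mem c ha
  -- The rank-one operators already carry `w` to every vector.
  obtain ⟨φ, hφ⟩ : ∃ φ : Dual ℂ V, φ w ≠ 0 := by
    by_contra! hφ
    exact hw0 ((Module.forall_dual_apply_eq_zero_iff ℂ w).1 hφ)
  have h1 := W.smul_mem (φ w)⁻¹ (hstab (φ.smulRight v))
  rwa [LinearMap.smulRight_apply, inv_smul_smul₀ hφ] at h1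


/-- If the `w i` are linearly independent intertwining maps out of an irreducible representation, then
they are injective and the sum of their images is direct. -/
theorem Representation.IsIrreducible.eq_zero_of_sum_intertwiningMap_eq_zero
    [FiniteDimensional ℂ V] {r : Representation ℂ G V} (hr : r.IsIrreducible)
    {V' : Type*} [AddCommGroup V'] [Module ℂ V'] {r' : Representation ℂ G V'}
    {ι : Type*} [Fintype ι] {w : ι → V →ₗ[ℂ] V'} (hw : ∀ i g v, w i (r g v) = r' g (w i v))
    (hind : LinearIndependent ℂ w) {u : ι → V} (hu : ∑ i, w i (u i) = 0) (i : ι) : u i = 0 := by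
  -- The relation survives the action of `G`, hence that of every endomorphism of `V`.
  have key : ∀ a : End ℂ V, ∑ j, w j (a (u j)) = 0 := fun a => by
    have ha : a ∈ Submodule.span ℂ (Set.range r) := hr.span_range_eq_top ▸ Submodule.mem_top
    induction ha using Submodule.span_induction with
    | mem f hf =>
      obtain ⟨g, rfl⟩ := hf
      simp_rw [hw, ← map_sum, hu, map_zero]
    | zero => simp
    | add a b _ _ ha hb => simp [Finset.sum_add_distrib, ha, hb]
    | smul c a _ ha => simp [← Finset.smul_sum, ha]
  refine (Module.forall_dual_apply_eq_zero_iff ℂ (u i)).1 fun φ => ?_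
  refine Fintype.linearIndependent_iff.1 hind (fun j => φ (u j)) ?_ i
  -- Apply the relation to the operators of rank one.
  ext v
  simpa using key (φ.smulRight v)

end Representations

/-! ### Degrees of a direct product -/

section Product

variable {G₁ G₂ : Type} [Group G₁] [Group G₂]

open scoped Pointwise

/-- The tensor product of irreducible representations of the factors is irreducible: its operators
span all tensor products of endomorphisms, hence all endomorphisms. -/
theorem mul_mem_characterDegrees_prod {d e : ℕ} (hd : d ∈ characterDegrees G₁)
    (he : e ∈ characterDegrees G₂) : d * e ∈ characterDegrees (G₁ × G₂) := by
  rw [mem_characterDegrees] at hd he ⊢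
  obtain ⟨U, _, _, _, r, hr, rfl⟩ := hd
  obtain ⟨W, _, _, _, s, hs, rfl⟩ := he
  have hU := ((Representation.isIrreducible_iff_forall_submodule r).1 hr).1
  have hW := ((Representation.isIrreducible_iff_forall_submodule s).1 hs).1
  refine ⟨U ⊗[ℂ] W, inferInstance, inferInstance, inferInstance,
    Representation.tprod (r.comp (MonoidHom.fst G₁ G₂)) (s.comp (MonoidHom.snd G₁ G₂)), ?_,
    finrank_tensorProduct⟩
  have hnt : Nontrivial (U ⊗[ℂ] W) := nontrivial_of_finrank_pos (R := ℂ) (by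
    rw [finrank_tensorProduct]; exact Nat.mul_pos finrank_pos finrank_pos)
  apply Representation.isIrreducible_of_span_range_eq_top
  set S := Submodule.span ℂ (Set.range (Representation.tprod (r.comp (MonoidHom.fst G₁ G₂))
    (s.comp (MonoidHom.snd G₁ G₂))))
  have h1 : ∀ (a : End ℂ U) (b : End ℂ W), TensorProduct.map a b ∈ S := fun a b => by
    have ha : a ∈ Submodule.span ℂ (Set.range r) := hr.span_range_eq_top ▸ Submodule.mem_top
    have hb : b ∈ Submodule.span ℂ (Set.range s) := hs.span_range_eq_top ▸ Submodule.mem_top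
    induction ha using Submodule.span_induction with
    | mem f hf =>
      obtain ⟨g, rfl⟩ := hf
      induction hb using Submodule.span_induction with
      | mem f hf => obtain ⟨h, rfl⟩ := hf; exact Submodule.subset_span ⟨(g, h), rfl⟩
      | zero => simp
      | add a b _ _ ha hb => rw [TensorProduct.map_add_right]; exact S.add_mem ha hb
      | smul c a _ ha => rw [TensorProduct.map_smul_right]; exact S.smul_mem c ha
    | zero => simp
    | add a b _ _ ha hb => rw [TensorProduct.map_add_left]; exact S.add_mem ha hb
    | smul c a _ ha => rw [TensorProduct.map_smul_left]; exact S.smul_mem c ha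
  rw [eq_top_iff]
  rintro f -
  obtain ⟨t, rfl⟩ := (homTensorHomEquiv ℂ U W U W).surjective f
  induction t using TensorProduct.induction_on with
  | zero => simp
  | tmul a b => simpa using h1 a b
  | add x y hx hy => rw [map_add]; exact S.add_mem hx hy

/-- Let `V` be an irreducible representation of `G₁ × G₂`, `U` an irreducible `G₁`-subspace and `W` an
irreducible `G₂`-subspace of the `G₁`-maps from `U` to `V`. Then evaluation `W ⊗ U → V` is bijective:
its image is invariant, and it is injective because independent maps have independent images. -/
theorem exists_mul_eq_of_mem_characterDegrees_prod {n : ℕ}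
    (hn : n ∈ characterDegrees (G₁ × G₂)) :
    ∃ d ∈ characterDegrees G₁, ∃ e ∈ characterDegrees G₂, d * e = n := by
  simp_rw [mem_characterDegrees] at hn ⊢
  obtain ⟨V, _, _, _, r, hr, rfl⟩ := hn
  obtain ⟨hV, hr⟩ := (Representation.isIrreducible_iff_forall_submodule r).1 hr
  set r₁ := r.comp (MonoidHom.inl G₁ G₂)
  obtain ⟨U, -, hU⟩ := Representation.exists_irreducible_le r₁ ⊤ (fun _ _ _ => Submodule.mem_top)
    top_ne_bot
  have hcomm : ∀ g h v, r (g, 1) (r (1, h) v) = r (1, h) (r (g, 1) v) := fun g h v => by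
    simp only [← Module.End.mul_apply, ← map_mul, Prod.mk_mul_mk, one_mul, mul_one]
  -- `G₂` acts by composition on the space of `G₁`-maps from `U` to `V`.
  let ρ : Representation ℂ G₂ (U.toSubmodule →ₗ[ℂ] V) :=
    { toFun := fun h => LinearMap.llcomp ℂ U.toSubmodule V V (r (1, h))
      map_one' := by ext; simp [← Prod.one_eq_mk]
      map_mul' := fun a b => by
        ext f u
        change r (1, a * b) (f u) = r (1, a) (r (1, b) (f u))
        rw [← Module.End.mul_apply, ← map_mul, Prod.mk_mul_mk, one_mul] }
  have hρ : ∀ h f u, ρ h f u = r (1, h) (f u) := fun _ _ _ => rfl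
  let X : Submodule ℂ (U.toSubmodule →ₗ[ℂ] V) :=
    { carrier := {f | ∀ g u, f (U.toRepresentation g u) = r (g, 1) (f u)}
      add_mem' := fun ha hb g u => by simp [ha g u, hb g u]
      zero_mem' := fun g u => by simp
      smul_mem' := fun c f hf g u => by simp [hf g u] }
  have hX : ∀ h, ∀ f ∈ X, ρ h f ∈ X := fun h f hf g u => by
    rw [hρ, hρ, hf, hcomm]
  obtain ⟨hU0, -⟩ := (Representation.isIrreducible_iff_forall_submodule _).1 hU
  have hX0 : X ≠ ⊥ := (Submodule.ne_bot_iff X).2 ⟨U.toSubmodule.subtype, fun g u => rfl, by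
    obtain ⟨u, hu⟩ := exists_ne (0 : U.toSubmodule)
    exact fun h => hu (Subtype.ext (LinearMap.congr_fun h u))⟩
  obtain ⟨W, hWX, hW⟩ := Representation.exists_irreducible_le ρ X hX hX0
  refine ⟨_, ⟨U.toSubmodule, _, _, inferInstance, _, hU, rfl⟩, _,
    ⟨W.toSubmodule, _, _, inferInstance, _, hW, rfl⟩, ?_⟩
  obtain ⟨hW0, -⟩ := (Representation.isIrreducible_iff_forall_submodule _).1 hW
  let b := finBasis ℂ W.toSubmodule
  -- Evaluation `W ⊗ U → V`, in the coordinates of a basis of `W`.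
  let E : (Fin (finrank ℂ W.toSubmodule) → U.toSubmodule) →ₗ[ℂ] V :=
    ∑ i, (b i : U.toSubmodule →ₗ[ℂ] V) ∘ₗ LinearMap.proj i
  have hE : ∀ u, E u = ∑ i, (b i : U.toSubmodule →ₗ[ℂ] V) (u i) := fun u => by simp [E]
  have hinj : Function.Injective E := by
    rw [← LinearMap.ker_eq_bot, LinearMap.ker_eq_bot']
    intro u hu
    rw [hE] at hu
    funext i
    exact hU.eq_zero_of_sum_intertwiningMap_eq_zero (r' := r₁)
      (fun i g v => hWX (b i).2 g v)
      (b.linearIndependent.map' W.toSubmodule.subtype (Submodule.ker_subtype _)) hu i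
  have hmem : ∀ f ∈ W.toSubmodule, ∀ u, f u ∈ LinearMap.range E := fun f hf u => by
    refine ⟨fun i => b.repr ⟨f, hf⟩ i • u, ?_⟩
    have := congrArg Subtype.val (b.sum_repr ⟨f, hf⟩)
    simp only [AddSubmonoidClass.coe_finsetSum, SetLike.val_smul] at this
    rw [hE]
    conv_rhs => rw [← this]
    simp
  have hsurj : LinearMap.range E = ⊤ := by
    refine (hr (LinearMap.range E) ?_).resolve_left ?_
    · rintro ⟨g, h⟩ _ ⟨u, rfl⟩
      rw [hE, map_sum]
      refine Submodule.sum_mem _ fun i _ => ?_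
      have h1 : r (g, h) ((b i : U.toSubmodule →ₗ[ℂ] V) (u i)) =
          ρ h (b i : U.toSubmodule →ₗ[ℂ] V) (U.toRepresentation g (u i)) := by
        rw [hρ, hWX (b i).2, ← Module.End.mul_apply, ← map_mul, Prod.mk_mul_mk, one_mul, mul_one]
      rw [h1]
      exact hmem _ (W.apply_mem_toSubmodule h (b i).2) _
    · obtain ⟨w, hw⟩ := exists_ne (0 : W.toSubmodule)
      obtain ⟨u, hu⟩ : ∃ u, (w : U.toSubmodule →ₗ[ℂ] V) u ≠ 0 := by
        by_contra! h
        exact hw (Subtype.ext (LinearMap.ext h))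
      exact (Submodule.ne_bot_iff _).2 ⟨_, hmem _ w.2 u, hu⟩
  rw [← (LinearEquiv.ofBijective E ⟨hinj, LinearMap.range_eq_top.1 hsurj⟩).finrank_eq,
    finrank_pi_fintype]
  simp [mul_comm]

theorem characterDegrees_prod :
    characterDegrees (G₁ × G₂) = characterDegrees G₁ * characterDegrees G₂ := by
  ext n
  rw [Set.mem_mul]
  refine ⟨exists_mul_eq_of_mem_characterDegrees_prod, ?_⟩
  rintro ⟨d, hd, e, he, rfl⟩
  exact mul_mem_characterDegrees_prod hd he

end Product

/-! ### Weights and fixed vectors -/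

section Eigenvectors

variable {V : Type*} [AddCommGroup V] [Module ℂ V]

/-- Operators that commute on a nonzero invariant subspace have a common eigenvector there: a minimal
nonzero subspace invariant under all of them consists of such vectors. -/
theorem exists_common_eigenvector [FiniteDimensional ℂ V] {ι : Type*} (f : ι → End ℂ V)
    (W : Submodule ℂ V) (hW0 : W ≠ ⊥) (hW : ∀ i, ∀ w ∈ W, f i w ∈ W)
    (hcomm : ∀ i j, ∀ w ∈ W, f i (f j w) = f j (f i w)) :
    ∃ v ∈ W, v ≠ 0 ∧ ∀ i, ∃ c : ℂ, f i v = c • v := by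
  obtain ⟨U, ⟨hUW, hU0, hU⟩, hmin⟩ := wellFounded_lt.has_min
    {U : Submodule ℂ V | U ≤ W ∧ U ≠ ⊥ ∧ ∀ i, ∀ w ∈ U, f i w ∈ U} ⟨W, le_rfl, hW0, hW⟩
  obtain ⟨v, hv, hv0⟩ := (Submodule.ne_bot_iff U).1 hU0
  refine ⟨v, hUW hv, hv0, fun i => ?_⟩
  have : Nontrivial U := Submodule.nontrivial_iff_ne_bot.2 hU0
  obtain ⟨c, hc⟩ := Module.End.exists_eigenvalue ((f i).restrict (hU i))
  obtain ⟨u, hu⟩ := hc.exists_hasEigenvector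
  -- The eigenspace of `f i` inside the minimal subspace `U` is invariant, hence all of `U`.
  have hlt := hmin (U ⊓ Module.End.eigenspace (f i) c) ⟨inf_le_left.trans hUW, ?_, ?_⟩
  · have h := (eq_of_le_of_not_lt inf_le_left hlt).ge hv
    exact ⟨c, Module.End.mem_eigenspace_iff.1 h.2⟩
  · refine (Submodule.ne_bot_iff _).2 ⟨u, ⟨u.2, ?_⟩, fun h => hu.2 (Subtype.ext h)⟩
    exact Module.End.mem_eigenspace_iff.2 (congrArg Subtype.val hu.apply_eq_smul)
  · rintro j w ⟨hw, hwc⟩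
    refine ⟨hU j w hw, Module.End.mem_eigenspace_iff.2 ?_⟩
    rw [hcomm i j w (hUW hw), Module.End.mem_eigenspace_iff.1 hwc, map_smul]

/-- Nonzero vectors on which a monoid acts through pairwise different characters are linearly
independent. -/
theorem linearIndependent_of_weights {A ι : Type*} [Monoid A] (r : Representation ℂ A V)
    (v : ι → V) (hv : ∀ i, v i ≠ 0) (ψ : ι → A → ℂ) (hψ : Function.Injective ψ)
    (h : ∀ i a, r a (v i) = ψ i a • v i) : LinearIndependent ℂ v := by
  let Ψ : ι → A →* ℂ := fun i =>
    { toFun := ψ i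
      map_one' := smul_left_injective ℂ (hv i) (by simp [← h])
      map_mul' := fun a b => smul_left_injective ℂ (hv i) (by
        simp only [← h, map_mul, Module.End.mul_apply]
        rw [h i b, map_smul, h, smul_smul, mul_comm]) }
  have hΨ : Function.Injective Ψ := fun i j hij => hψ (congrArg (fun f : A →* ℂ => ⇑f) hij)
  have hli := (linearIndependent_monoidHom A ℂ).comp Ψ hΨ
  rw [linearIndependent_iff'] at hli ⊢
  intro s a ha i hi
  obtain ⟨φ, hφ⟩ : ∃ φ : Dual ℂ V, φ (v i) ≠ 0 := by
    by_contra! hφ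
    exact hv i ((Module.forall_dual_apply_eq_zero_iff ℂ (v i)).1 hφ)
  have h1 := hli s (fun j => a j * φ (v j)) ?_ i hi
  · exact (mul_eq_zero.1 h1).resolve_right hφ
  · funext g
    have h2 := congrArg (fun w => φ (r g w)) ha
    simp only [map_sum, map_smul, h, map_zero] at h2
    rw [Finset.sum_apply, Pi.zero_apply, ← h2]
    refine Finset.sum_congr rfl fun j _ => ?_
    change a j * φ (v j) * ψ j g = _
    simp only [smul_eq_mul]
    ring

variable {G : Type*} [Group G]

/-- Schur's lemma for central elements. -/
theorem Representation.IsIrreducible.exists_smul_of_commute [FiniteDimensional ℂ V]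
    {r : Representation ℂ G V} (hr : r.IsIrreducible) {z : G} (hz : ∀ g, g * z = z * g) :
    ∃ c : ℂ, ∀ v, r z v = c • v := by
  obtain ⟨hV, hr⟩ := (Representation.isIrreducible_iff_forall_submodule r).1 hr
  obtain ⟨c, hc⟩ := Module.End.exists_eigenvalue (r z)
  refine ⟨c, fun v => Module.End.mem_eigenspace_iff.1 ?_⟩
  have := (hr (Module.End.eigenspace (r z) c) fun g w hw => ?_).resolve_left hc
  · exact this ▸ Submodule.mem_top
  · rw [Module.End.mem_eigenspace_iff] at hw ⊢
    rw [← Module.End.mul_apply, ← map_mul, ← hz, map_mul, Module.End.mul_apply, hw, map_smul]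

/-- If a normal subgroup acts nontrivially on a representation of a finite group, it acts
nontrivially on some irreducible subrepresentation. -/
theorem Representation.exists_irreducible_not_trivial [Finite G] [FiniteDimensional ℂ V]
    (r : Representation ℂ G V) (N : Subgroup G) [N.Normal] (hN : ∃ n ∈ N, r n ≠ 1) :
    ∃ U : Subrepresentation r, U.toRepresentation.IsIrreducible ∧
      ∃ n ∈ N, U.toRepresentation n ≠ 1 := by
  have := Fintype.ofFinite N
  let E : End ℂ V := ∑ n : N, r n
  have hE : ∀ v, E v = ∑ n : N, r n v := fun v => by simp [E]
  obtain ⟨n₀, hn₀, hr₀⟩ := hN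
  obtain ⟨v₀, hv₀⟩ : ∃ v, r n₀ v ≠ v := by
    by_contra! h
    exact hr₀ (LinearMap.ext h)
  -- The kernel of the averaging operator is a nonzero invariant subspace without fixed vectors.
  have hinv : ∀ g, ∀ w ∈ LinearMap.ker E, r g w ∈ LinearMap.ker E := fun g w hw => by
    rw [LinearMap.mem_ker, hE] at hw ⊢
    have h1 : r g (∑ n : N, r n w) = 0 := by rw [hw, map_zero]
    rw [map_sum] at h1
    rw [← h1]
    refine Fintype.sum_equiv (MulAut.conjNormal g⁻¹).toEquiv _ _ fun n => ?_
    simp only [← Module.End.mul_apply, ← map_mul]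
    simp [mul_assoc]
  have hne : LinearMap.ker E ≠ ⊥ := by
    refine (Submodule.ne_bot_iff _).2 ⟨r n₀ v₀ - v₀, ?_, sub_ne_zero.2 hv₀⟩
    rw [LinearMap.mem_ker, map_sub, sub_eq_zero, hE, hE]
    refine Fintype.sum_equiv (Equiv.mulRight ⟨n₀, hn₀⟩) _ _ fun n => ?_
    simp
  obtain ⟨U, hUE, hU⟩ := r.exists_irreducible_le (LinearMap.ker E) hinv hne
  refine ⟨U, hU, ?_⟩
  by_contra! h
  obtain ⟨hU0, -⟩ := (Representation.isIrreducible_iff_forall_submodule _).1 hU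
  obtain ⟨u, hu⟩ := exists_ne (0 : U.toSubmodule)
  have h1 : E u = 0 := hUE u.2
  have h2 : ∀ n : N, r n u = u := fun n =>
    congrArg Subtype.val (LinearMap.congr_fun (h n n.2) u)
  rw [hE] at h1
  simp only [h2, Finset.sum_const, Finset.card_univ] at h1
  rw [← Nat.cast_smul_eq_nsmul ℂ] at h1
  rcases smul_eq_zero.1 h1 with h1 | h1
  · exact Fintype.card_ne_zero (Nat.cast_eq_zero.1 h1)
  · exact hu (Subtype.ext h1)

/-- A linearly independent family with invariant span is a basis of an irreducible
representation. -/
theorem Representation.IsIrreducible.finrank_eq_card {r : Representation ℂ G V}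
    (hr : r.IsIrreducible) {ι : Type*} [Fintype ι] [Nonempty ι] {v : ι → V}
    (hv : LinearIndependent ℂ v)
    (hinv : ∀ g i, r g (v i) ∈ Submodule.span ℂ (Set.range v)) :
    finrank ℂ V = Fintype.card ι := by
  obtain ⟨-, hr⟩ := (Representation.isIrreducible_iff_forall_submodule r).1 hr
  have htop : Submodule.span ℂ (Set.range v) = ⊤ := by
    refine (hr _ fun g w hw => ?_).resolve_left fun h => ?_
    · induction hw using Submodule.span_induction with
      | mem x hx => obtain ⟨i, rfl⟩ := hx; exact hinv g i
      | zero => simp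
      | add a b _ _ ha hb => rw [map_add]; exact Submodule.add_mem _ ha hb
      | smul c a _ ha => rw [map_smul]; exact Submodule.smul_mem _ _ ha
    · obtain ⟨i⟩ := ‹Nonempty ι›
      exact hv.ne_zero i (Submodule.span_eq_bot.1 h _ ⟨i, rfl⟩)
  exact finrank_eq_card_basis (Basis.mk hv htop.ge)

end Eigenvectors

/-! ### The Heisenberg group extended by a torus -/

/-- The group of matrices `!![1, x, z; 0, c, y; 0, 0, 1]` over a field `F`, with `c` in a given
subgroup `C` of `Fˣ`: the semidirect product of the Heisenberg group of `F` with `C`, which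
centralizes the centre and acts freely on the nontrivial elements of the central quotient. -/
@[ext]
structure HeisenbergTorus (F : Type) [Field F] (C : Subgroup Fˣ) where
  /-- the entry in position `(1, 2)` -/
  x : F
  /-- the entry in position `(2, 3)` -/
  y : F
  /-- the entry in position `(1, 3)` -/
  z : F
  /-- the middle diagonal entry -/
  c : C

namespace HeisenbergTorus

variable {F : Type} [Field F] {C : Subgroup Fˣ}

instance : Mul (HeisenbergTorus F C) :=
  ⟨fun g h => ⟨h.x + g.x * (h.c : Fˣ), g.y + (g.c : Fˣ) * h.y, h.z + g.z + g.x * h.y, g.c * h.c⟩⟩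

instance : One (HeisenbergTorus F C) := ⟨⟨0, 0, 0, 1⟩⟩

instance : Inv (HeisenbergTorus F C) :=
  ⟨fun g => ⟨-g.x * ((g.c⁻¹ : C) : Fˣ), -((g.c⁻¹ : C) : Fˣ) * g.y,
    -g.z + g.x * ((g.c⁻¹ : C) : Fˣ) * g.y, g.c⁻¹⟩⟩

@[simp] theorem mul_x (g h : HeisenbergTorus F C) : (g * h).x = h.x + g.x * (h.c : Fˣ) := rfl
@[simp] theorem mul_y (g h : HeisenbergTorus F C) : (g * h).y = g.y + (g.c : Fˣ) * h.y := rfl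
@[simp] theorem mul_z (g h : HeisenbergTorus F C) : (g * h).z = h.z + g.z + g.x * h.y := rfl
@[simp] theorem mul_c (g h : HeisenbergTorus F C) : (g * h).c = g.c * h.c := rfl
@[simp] theorem one_x : (1 : HeisenbergTorus F C).x = 0 := rfl
@[simp] theorem one_y : (1 : HeisenbergTorus F C).y = 0 := rfl
@[simp] theorem one_z : (1 : HeisenbergTorus F C).z = 0 := rfl
@[simp] theorem one_c : (1 : HeisenbergTorus F C).c = 1 := rfl
@[simp] theorem inv_x (g : HeisenbergTorus F C) : g⁻¹.x = -g.x * ((g.c⁻¹ : C) : Fˣ) := rfl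
@[simp] theorem inv_y (g : HeisenbergTorus F C) : g⁻¹.y = -((g.c⁻¹ : C) : Fˣ) * g.y := rfl
@[simp] theorem inv_z (g : HeisenbergTorus F C) :
    g⁻¹.z = -g.z + g.x * ((g.c⁻¹ : C) : Fˣ) * g.y := rfl
@[simp] theorem inv_c (g : HeisenbergTorus F C) : g⁻¹.c = g.c⁻¹ := rfl

instance : Group (HeisenbergTorus F C) :=
  Group.ofLeftAxioms
    (fun g h k => by
      ext <;> simp [mul_assoc] <;> ring)
    (fun g => by ext <;> simp)
    (fun g => by ext <;> simp)

instance [Finite F] : Finite (HeisenbergTorus F C) :=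
  Finite.of_injective (fun g => (g.x, g.y, g.z, g.c)) fun g h hgh => by
    simp only [Prod.mk.injEq] at hgh
    exact HeisenbergTorus.ext hgh.1 hgh.2.1 hgh.2.2.1 hgh.2.2.2

/-- The diagonal matrix `diag(1, c, 1)`. -/
def diag (c : C) : HeisenbergTorus F C := ⟨0, 0, 0, c⟩

/-- The elementary matrix with entry `x` in position `(1, 2)`. -/
def elemX (C : Subgroup Fˣ) (x : F) : HeisenbergTorus F C := ⟨x, 0, 0, 1⟩

/-- The elementary matrix with entry `y` in position `(2, 3)`. -/
def elemY (C : Subgroup Fˣ) (y : F) : HeisenbergTorus F C := ⟨0, y, 0, 1⟩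

/-- The central matrix with entry `z` in position `(1, 3)`. -/
def elemZ (C : Subgroup Fˣ) (z : F) : HeisenbergTorus F C := ⟨0, 0, z, 1⟩

/-- The projection onto the middle diagonal entry. -/
def toTorus (F : Type) [Field F] (C : Subgroup Fˣ) : HeisenbergTorus F C →* C where
  toFun := c
  map_one' := rfl
  map_mul' _ _ := rfl

theorem eq_mul (g : HeisenbergTorus F C) :
    g = elemY C g.y * diag g.c * elemX C g.x * elemZ C g.z := by
  ext <;> simp [elemX, elemY, elemZ, diag]

theorem elemX_zero : elemX C 0 = 1 := rfl

theorem elemX_mul_elemX (x x' : F) : elemX C x * elemX C x' = elemX C (x + x') := by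
  ext <;> simp [elemX, add_comm]

theorem elemY_mul_elemY (y y' : F) : elemY C y * elemY C y' = elemY C (y + y') := by
  ext <;> simp [elemY]

theorem elemZ_mul_elemZ (z z' : F) : elemZ C z * elemZ C z' = elemZ C (z + z') := by
  ext <;> simp [elemZ, add_comm]

theorem diag_mul_diag (c c' : C) : (diag c * diag c' : HeisenbergTorus F C) = diag (c * c') := by
  ext <;> simp [diag]

theorem diag_mul_elemX (c : C) (x : F) :
    diag c * elemX C x = elemX C (x * ((c⁻¹ : C) : Fˣ)) * diag c := by
  ext <;> simp [diag, elemX]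

theorem elemY_mul_diag (c : C) (y : F) :
    elemY C y * diag c = diag c * elemY C (((c⁻¹ : C) : Fˣ) * y) := by
  ext <;> simp [diag, elemY]

theorem elemY_mul_elemX (x y : F) :
    elemY C y * elemX C x = elemX C x * elemY C y * elemZ C (-(x * y)) := by
  ext <;> simp [elemX, elemY, elemZ]

theorem mul_elemZ (g : HeisenbergTorus F C) (z : F) : g * elemZ C z = elemZ C z * g := by
  ext <;> simp [elemZ, add_comm]

/-- The Heisenberg group, as the normal subgroup of the upper unitriangular matrices. -/
abbrev unipotent (F : Type) [Field F] (C : Subgroup Fˣ) : Subgroup (HeisenbergTorus F C) :=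
  (toTorus F C).ker

theorem mem_unipotent {g : HeisenbergTorus F C} : g ∈ unipotent F C ↔ g.c = 1 := Iff.rfl

/-- The subgroup of the matrices `elemZ C z`. -/
def centre (F : Type) [Field F] (C : Subgroup Fˣ) : Subgroup (HeisenbergTorus F C) where
  carrier := Set.range (elemZ C)
  mul_mem' := by
    rintro _ _ ⟨z, rfl⟩ ⟨z', rfl⟩
    exact ⟨z + z', (elemZ_mul_elemZ z z').symm⟩
  one_mem' := ⟨0, rfl⟩
  inv_mem' := by
    rintro _ ⟨z, rfl⟩
    exact ⟨-z, by ext <;> simp [elemZ]⟩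

instance : (centre F C).Normal := ⟨by
  rintro _ ⟨z, rfl⟩ g
  exact ⟨z, by rw [mul_elemZ, mul_inv_cancel_right]⟩⟩

instance : Group.IsSolvable (HeisenbergTorus F C) := by
  -- The abelian factors are the centre, the pairs `(x, y)` and `C`.
  let f : Multiplicative F →* unipotent F C :=
    { toFun := fun z => ⟨elemZ C z.toAdd, rfl⟩
      map_one' := rfl
      map_mul' := fun a b => Subtype.ext (elemZ_mul_elemZ _ _).symm }
  let g : unipotent F C →* Multiplicative (F × F) :=
    { toFun := fun g => Multiplicative.ofAdd (g.1.x, g.1.y)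
      map_one' := rfl
      map_mul' := fun a b => by
        have ha := mem_unipotent.1 a.2
        have hb := mem_unipotent.1 b.2
        rw [← ofAdd_add]
        simp [ha, hb, add_comm] }
  have : Group.IsSolvable (unipotent F C) := by
    refine Group.isSolvable_of_ker_le_range f g fun a ha => ⟨Multiplicative.ofAdd a.1.z, ?_⟩
    have h1 : (a.1.x, a.1.y) = (0, 0) := ha
    rw [Prod.mk.injEq] at h1
    exact Subtype.ext (HeisenbergTorus.ext h1.1.symm h1.2.symm rfl (mem_unipotent.1 a.2).symm)
  exact Group.isSolvable_of_ker_le_range (unipotent F C).subtype (toTorus F C) (by simp)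

/-! ### Character degrees of the Heisenberg group extended by a torus -/

section Representations

variable {V : Type*} [AddCommGroup V] [Module ℂ V]
  {r : Representation ℂ (HeisenbergTorus F C) V}

/-- If the matrices `elemZ C z` act through a nontrivial character `χ`, then some nonzero vector is
fixed by all `elemY C y`: the sum over `x` of the conjugates by `elemX C x` of the averaging
operator of these matrices is a nonzero scalar. -/
theorem exists_fixed_by_elemY [Fintype F] [Nontrivial V] {χ : AddChar F ℂ} (hχ : χ ≠ 1)
    (hZ : ∀ z v, r (elemZ C z) v = χ z • v) : ∃ v ≠ 0, ∀ y, r (elemY C y) v = v := by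
  classical
  by_contra! hfix
  have hE : ∀ v, ∑ y, r (elemY C y) v = 0 := fun v => by
    by_contra hne
    obtain ⟨y, hy⟩ := hfix _ hne
    apply hy
    rw [map_sum]
    refine Fintype.sum_equiv (Equiv.addLeft y) _ _ fun y' => ?_
    rw [← Module.End.mul_apply, ← map_mul, elemY_mul_elemY, Equiv.coe_addLeft]
  obtain ⟨v, hv⟩ := exists_ne (0 : V)
  have h1 : ∑ x, r (elemX C (-x)) (∑ y, r (elemY C y) (r (elemX C x) v)) = 0 := by simp [hE]
  have h2 : ∀ x y, r (elemX C (-x)) (r (elemY C y) (r (elemX C x) v)) =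
      χ (x * -y) • r (elemY C y) v := fun x y => by
    rw [mul_neg, ← map_smul, ← hZ]
    simp only [← Module.End.mul_apply, ← map_mul]
    rw [elemY_mul_elemX, ← mul_assoc, ← mul_assoc, elemX_mul_elemX, neg_add_cancel, elemX_zero,
      one_mul]
  simp_rw [map_sum, h2] at h1
  rw [Finset.sum_comm] at h1
  simp_rw [← Finset.sum_smul, AddChar.sum_mulShift _ (AddChar.IsPrimitive.of_ne_one hχ)] at h1
  have h3 : r (elemY C 0) v = v := by
    change r 1 v = v
    simp
  simp [h3, hv] at h1

/-- An irreducible representation on which the centre acts nontrivially has a basis permuted up to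
scalars by the group and indexed by `F`. -/
theorem finrank_eq_card_field [FiniteDimensional ℂ V] [Fintype F] (hr : r.IsIrreducible)
    (hZ : ∃ z, r (elemZ C z) ≠ 1) : finrank ℂ V = Fintype.card F := by
  obtain ⟨hV, -⟩ := (Representation.isIrreducible_iff_forall_submodule r).1 hr
  choose f hf using fun z => hr.exists_smul_of_commute (fun g => mul_elemZ g z)
  obtain ⟨v₀, hv₀⟩ := exists_ne (0 : V)
  let χ : AddChar F ℂ :=
    { toFun := f
      map_zero_eq_one' := smul_left_injective ℂ hv₀ (by
        change f 0 • v₀ = (1 : ℂ) • v₀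
        rw [← hf, one_smul]
        change r 1 v₀ = v₀
        simp)
      map_add_eq_mul' := fun a b => smul_left_injective ℂ hv₀ (by
        change f (a + b) • v₀ = (f a * f b) • v₀
        rw [← hf, ← elemZ_mul_elemZ, map_mul, Module.End.mul_apply, hf, hf, smul_smul, mul_comm]) }
  have hχZ : ∀ z v, r (elemZ C z) v = χ z • v := hf
  have hχ : χ ≠ 1 := by
    rintro h
    obtain ⟨z, hz⟩ := hZ
    exact hz (LinearMap.ext fun v => by rw [hχZ, h]; simp)
  have hprim := AddChar.IsPrimitive.of_ne_one hχ
  obtain ⟨v₁, hv₁, hfix₁⟩ := exists_fixed_by_elemY hχ hχZ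
  let W : Submodule ℂ V :=
    { carrier := {v | ∀ y, r (elemY C y) v = v}
      add_mem' := fun ha hb y => by rw [map_add, ha, hb]
      zero_mem' := fun y => map_zero _
      smul_mem' := fun c v hv y => by rw [map_smul, hv] }
  -- The diagonal matrices normalize the matrices `elemY C y`, hence act on their fixed vectors.
  obtain ⟨v, hvW, hv0, hv⟩ := exists_common_eigenvector (fun c : C => r (diag c)) W
    ((Submodule.ne_bot_iff W).2 ⟨v₁, hfix₁, hv₁⟩)
    (fun c w hw y => by
      rw [← Module.End.mul_apply, ← map_mul, elemY_mul_diag, map_mul, Module.End.mul_apply, hw])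
    (fun c c' w _ => by
      simp only [← Module.End.mul_apply, ← map_mul, diag_mul_diag, mul_comm])
  have hX0 : ∀ x, r (elemX C x) v ≠ 0 := fun x h => hv0 (by
    have h1 : r (elemX C (-x)) (r (elemX C x) v) = 0 := by rw [h, map_zero]
    rw [← Module.End.mul_apply, ← map_mul, elemX_mul_elemX, neg_add_cancel] at h1
    change r 1 v = 0 at h1
    simpa using h1)
  have hYX : ∀ x y, r (elemY C y) (r (elemX C x) v) = χ (-x * y) • r (elemX C x) v :=
    fun x y => by
      rw [neg_mul, ← hχZ, ← Module.End.mul_apply, ← map_mul, elemY_mul_elemX, mul_elemZ,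
        map_mul, map_mul, Module.End.mul_apply, Module.End.mul_apply, hvW]
  let Y : Multiplicative F →* HeisenbergTorus F C :=
    { toFun := fun y => elemY C y.toAdd
      map_one' := rfl
      map_mul' := fun a b => (elemY_mul_elemY _ _).symm }
  refine hr.finrank_eq_card (v := fun x => r (elemX C x) v)
    (linearIndependent_of_weights (r.comp Y) _ hX0 (fun x y => χ (-x * y.toAdd)) ?_
      fun x y => hYX x y.toAdd) fun g x => ?_
  · intro x x' hxx
    refine neg_injective (AddChar.to_mulShift_inj_of_isPrimitive hprim ?_)
    ext y
    exact congrFun hxx (Multiplicative.ofAdd y)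
  · rw [eq_mul g]
    simp only [map_mul, Module.End.mul_apply]
    obtain ⟨a, ha⟩ := hv g.c
    rw [hχZ, map_smul, map_smul, map_smul, ← Module.End.mul_apply (r (elemX C g.x)), ← map_mul,
      elemX_mul_elemX, ← Module.End.mul_apply (r (diag g.c)), ← map_mul, diag_mul_elemX, map_mul,
      Module.End.mul_apply, ha, map_smul, map_smul, hYX]
    exact Submodule.smul_mem _ _ (Submodule.smul_mem _ _ (Submodule.smul_mem _ _
      (Submodule.subset_span ⟨_, rfl⟩)))

end Representations

theorem exists_mul_eq_mul_elemZ {a b : HeisenbergTorus F C} (ha : a ∈ unipotent F C)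
    (hb : b ∈ unipotent F C) : a * b = b * a * elemZ C (a.x * b.y - b.x * a.y) := by
  rw [mem_unipotent] at ha hb
  ext <;> simp [ha, hb, elemZ] <;> ring

theorem mul_diag (a : HeisenbergTorus F C) (c : C) :
    a * diag c = diag c * ((diag c)⁻¹ * a * diag c) := by
  group

section Representations

variable {V : Type*} [AddCommGroup V] [Module ℂ V]
  {r : Representation ℂ (HeisenbergTorus F C) V}

/-- The vectors fixed by the normal subgroup of unipotent matrices form an invariant subspace. -/
theorem eq_one_of_fixed_by_unipotent (hr : r.IsIrreducible) {v : V} (hv : v ≠ 0)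
    (hfix : ∀ a ∈ unipotent F C, r a v = v) {a : HeisenbergTorus F C} (ha : a ∈ unipotent F C) :
    r a = 1 := by
  obtain ⟨-, hr⟩ := (Representation.isIrreducible_iff_forall_submodule r).1 hr
  let W : Submodule ℂ V :=
    { carrier := {v | ∀ a ∈ unipotent F C, r a v = v}
      add_mem' := fun ha hb y hy => by rw [map_add, ha y hy, hb y hy]
      zero_mem' := fun y _ => map_zero _
      smul_mem' := fun c v hv y hy => by rw [map_smul, hv y hy] }
  have hW : W = ⊤ := by
    refine (hr W fun g w hw b hb => ?_).resolve_left
      ((Submodule.ne_bot_iff W).2 ⟨v, hfix, hv⟩)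
    have h1 := hw (g⁻¹ * b * g⁻¹⁻¹) ((inferInstance : (unipotent F C).Normal).conj_mem b hb g⁻¹)
    rw [← Module.End.mul_apply, ← map_mul]
    conv_rhs => rw [← h1, ← Module.End.mul_apply, ← map_mul]
    congr 2
    group
  ext w
  have hw : w ∈ W := hW ▸ Submodule.mem_top
  exact hw a ha

variable [FiniteDimensional ℂ V]

/-- An irreducible representation on which the centre acts trivially and the unipotent matrices do
not has a basis permuted up to scalars by the group and indexed by `C`. -/
theorem finrank_eq_card_torus [Fintype C] (hr : r.IsIrreducible)
    (hZ : ∀ z, r (elemZ C z) = 1) (hP : ∃ a ∈ unipotent F C, r a ≠ 1) :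
    finrank ℂ V = Fintype.card C := by
  obtain ⟨hV, -⟩ := (Representation.isIrreducible_iff_forall_submodule r).1 hr
  obtain ⟨v, -, hv0, hv⟩ := exists_common_eigenvector (fun a : unipotent F C => r a) ⊤ top_ne_bot
    (fun _ _ _ => Submodule.mem_top) fun a b w _ => by
      rw [← Module.End.mul_apply, ← map_mul, exists_mul_eq_mul_elemZ a.2 b.2, map_mul, hZ, mul_one,
        map_mul, Module.End.mul_apply]
  choose ψ hψ using hv
  have hψ1 : ∀ a : HeisenbergTorus F C, ∀ ha : a ∈ unipotent F C, r a v = ψ ⟨a, ha⟩ • v :=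
    fun a ha => hψ ⟨a, ha⟩
  have hconj : ∀ (c : C), ∀ a ∈ unipotent F C, (diag c)⁻¹ * a * diag c ∈ unipotent F C :=
    fun c a ha => by
      simpa using (inferInstance : (unipotent F C).Normal).conj_mem a ha (diag c)⁻¹
  have hD0 : ∀ c, r (diag c) v ≠ 0 := fun c h => hv0 (by
    have h1 : r (diag c)⁻¹ (r (diag c) v) = 0 := by rw [h, map_zero]
    rwa [← Module.End.mul_apply, ← map_mul, inv_mul_cancel, map_one, Module.End.one_apply] at h1)
  have hPD : ∀ (c : C) (a : unipotent F C), r a (r (diag c) v) =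
      ψ ⟨(diag c)⁻¹ * a * diag c, hconj c a a.2⟩ • r (diag c) v := fun c a => by
    rw [← Module.End.mul_apply, ← map_mul, mul_diag, map_mul, Module.End.mul_apply, hψ1, map_smul]
  refine hr.finrank_eq_card (v := fun c => r (diag c) v)
    (linearIndependent_of_weights (r.comp (unipotent F C).subtype) _ hD0
      (fun c a => ψ ⟨(diag c)⁻¹ * a * diag c, hconj c a a.2⟩) ?_ hPD) fun g c => ?_
  · intro c d hcd
    by_contra hne
    have hne' : ((c : Fˣ) : F) - (d : Fˣ) ≠ 0 := fun h =>
      hne (Subtype.ext (Units.ext (sub_eq_zero.1 h)))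
    have hne'' : ((c : Fˣ) : F)⁻¹ - ((d : Fˣ) : F)⁻¹ ≠ 0 := fun h =>
      hne (Subtype.ext (Units.ext (inv_injective (sub_eq_zero.1 h))))
    have heq : ∀ a ∈ unipotent F C,
        r ((diag c)⁻¹ * a * diag c) v = r ((diag d)⁻¹ * a * diag d) v := fun a ha => by
      rw [hψ1 _ (hconj c a ha), hψ1 _ (hconj d a ha)]
      exact congrArg (· • v) (congrFun hcd ⟨a, ha⟩)
    have hcancel : ∀ a b : HeisenbergTorus F C, r a v = r b v → r (b⁻¹ * a) v = v :=
      fun a b h => by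
        rw [map_mul, Module.End.mul_apply, h, ← Module.End.mul_apply, ← map_mul, inv_mul_cancel,
          map_one, Module.End.one_apply]
    -- A character of the unipotent matrices fixed by `c d⁻¹ ≠ 1` is trivial, because `c d⁻¹` acts
    -- on both coordinates without fixed points.
    have hX : ∀ x, r (elemX C x) v = v := fun x => by
      have h1 := hcancel _ _ (heq (elemX C (x / ((c : Fˣ) - (d : Fˣ) : F))) rfl)
      convert! h1 using 3
      ext <;> simp [elemX, diag]
      field_simp
      ring
    have hY : ∀ y, r (elemY C y) v = v := fun y => by
      have h1 := hcancel _ _ (heq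
        (elemY C (y / (((c : Fˣ) : F)⁻¹ - ((d : Fˣ) : F)⁻¹))) rfl)
      convert! h1 using 3
      ext <;> simp [elemY, diag]
      rw [neg_add_eq_sub, ← sub_mul, mul_comm, div_mul_cancel₀ _ hne'']
    obtain ⟨a, ha, hra⟩ := hP
    refine hra (eq_one_of_fixed_by_unipotent hr hv0 (fun b hb => ?_) ha)
    have hb' : diag b.c = (1 : HeisenbergTorus F C) := by rw [mem_unipotent.1 hb]; rfl
    rw [eq_mul b, hb', map_mul, map_mul, map_mul, hZ, map_one, mul_one, mul_one,
      Module.End.mul_apply, hX, hY]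
  · have hmem : (diag g.c)⁻¹ * g ∈ unipotent F C := by
      rw [mem_unipotent]
      exact inv_mul_cancel g.c
    have h1 := hPD c ⟨_, hmem⟩
    have h2 : r g (r (diag c) v) = r (diag g.c) (r ((diag g.c)⁻¹ * g) (r (diag c) v)) := by
      rw [← Module.End.mul_apply (r (diag g.c)), ← map_mul, mul_inv_cancel_left]
    rw [h2, h1, map_smul, ← Module.End.mul_apply, ← map_mul, diag_mul_diag]
    exact Submodule.smul_mem _ _ (Submodule.subset_span ⟨_, rfl⟩)

/-- If the unipotent matrices act trivially, the representation is one of the abelian group `C`. -/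
theorem finrank_eq_one (hr : r.IsIrreducible) (hP : ∀ a ∈ unipotent F C, r a = 1) :
    finrank ℂ V = 1 := by
  obtain ⟨hV, -⟩ := (Representation.isIrreducible_iff_forall_submodule r).1 hr
  have hcomm : ∀ g h, r g * r h = r h * r g := fun g h => by
    have h1 : (h * g)⁻¹ * (g * h) ∈ unipotent F C := by
      rw [mem_unipotent]
      change (h.c * g.c)⁻¹ * (g.c * h.c) = 1
      rw [mul_comm g.c, inv_mul_cancel]
    rw [← map_mul, ← map_mul, ← mul_inv_cancel_left (h * g) (g * h), map_mul, hP _ h1, mul_one]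
  obtain ⟨v, -, hv0, hv⟩ := exists_common_eigenvector r ⊤ top_ne_bot
    (fun _ _ _ => Submodule.mem_top) fun g h w _ => by
      rw [← Module.End.mul_apply, hcomm, Module.End.mul_apply]
  refine hr.finrank_eq_card (v := fun _ : Unit => v) (linearIndependent_unique_iff.2 hv0)
    fun g _ => ?_
  obtain ⟨c, hc⟩ := hv g
  rw [hc]
  exact Submodule.smul_mem _ _ (Submodule.subset_span ⟨(), rfl⟩)

end Representations

/-- The action on `F` by the affine maps `t ↦ c t + y`. -/
abbrev affineAction (F : Type) [Field F] (C : Subgroup Fˣ) : MulAction (HeisenbergTorus F C) F where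
  smul g t := (g.c : Fˣ) * t + g.y
  one_smul t := by
    change ((1 : Fˣ) : F) * t + 0 = t
    simp
  mul_smul g h t := by
    change ((g.c * h.c : C) : Fˣ) * t + (g.y + (g.c : Fˣ) * h.y) =
      (g.c : Fˣ) * ((h.c : Fˣ) * t + h.y) + g.y
    simp
    ring

/-- The degrees other than `1` are realized inside the regular representation, on which the centre
acts nontrivially, and inside the permutation representation of the affine action, on which the
unipotent matrices act nontrivially and the centre trivially. -/
theorem characterDegrees_eq [Fintype F] [Fintype C] :
    characterDegrees (HeisenbergTorus F C) = {1, Fintype.card F, Fintype.card C} := by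
  ext d
  simp only [mem_characterDegrees, Set.mem_insert_iff, Set.mem_singleton_iff]
  constructor
  · rintro ⟨V, _, _, _, r, hr, rfl⟩
    by_cases hZ : ∃ z, r (elemZ C z) ≠ 1
    · exact Or.inr (Or.inl (finrank_eq_card_field hr hZ))
    · by_cases hP : ∃ a ∈ unipotent F C, r a ≠ 1
      · exact Or.inr (Or.inr (finrank_eq_card_torus hr (by simpa using hZ) hP))
      · exact Or.inl (finrank_eq_one hr (by simpa using hP))
  · rintro (rfl | rfl | rfl)
    · refine ⟨ℂ, inferInstance, inferInstance, inferInstance, 1, ?_, finrank_self ℂ⟩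
      rw [Representation.isIrreducible_iff_forall_submodule]
      exact ⟨inferInstance, fun W _ => eq_bot_or_eq_top W⟩
    · obtain ⟨U, hU, _, ⟨z, rfl⟩, hz⟩ := Representation.exists_irreducible_not_trivial
        (Representation.ofMulAction ℂ (HeisenbergTorus F C) (HeisenbergTorus F C)) (centre F C)
        ⟨elemZ C 1, ⟨1, rfl⟩, fun h => by
          have h1 := LinearMap.congr_fun h (MonoidAlgebra.single 1 1)
          rw [Representation.ofMulAction_single, Module.End.one_apply,
            MonoidAlgebra.single_left_inj one_ne_zero] at h1
          rw [smul_eq_mul, mul_one] at h1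
          exact one_ne_zero (α := F) (congrArg HeisenbergTorus.z h1)⟩
      exact ⟨_, _, _, inferInstance, _, hU, finrank_eq_card_field hU ⟨z, hz⟩⟩
    · let _ := affineAction F C
      obtain ⟨U, hU, hP⟩ := Representation.exists_irreducible_not_trivial
        (Representation.ofMulAction ℂ (HeisenbergTorus F C) F) (unipotent F C)
        ⟨elemY C 1, rfl, fun h => by
          have h1 := LinearMap.congr_fun h (MonoidAlgebra.single 0 1)
          rw [Representation.ofMulAction_single, Module.End.one_apply,
            MonoidAlgebra.single_left_inj one_ne_zero] at h1
          change ((1 : Fˣ) : F) * 0 + 1 = 0 at h1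
          simp at h1⟩
      refine ⟨_, _, _, inferInstance, _, hU, finrank_eq_card_torus hU (fun z => ?_) hP⟩
      ext u : 1
      apply Subtype.ext
      have h1 : Representation.ofMulAction ℂ (HeisenbergTorus F C) F (elemZ C z) = 1 := by
        refine MonoidAlgebra.lhom_ext' fun t => LinearMap.ext fun a => ?_
        simp only [LinearMap.comp_apply, MonoidAlgebra.lsingle_apply, Module.End.one_apply,
          Representation.ofMulAction_single]
        congr 1
        change ((1 : Fˣ) : F) * t + 0 = t
        simp
      exact LinearMap.congr_fun h1 u

end HeisenbergTorus

/-! ### Realizing joins of small graphs -/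

theorem characterDegrees_unit : characterDegrees Unit = {1} := by
  ext d
  simp only [mem_characterDegrees, Set.mem_singleton_iff]
  constructor
  · rintro ⟨V, _, _, _, r, hr, rfl⟩
    exact Representation.IsIrreducible.finrank_eq_one_of_isMulCommutative r
  · rintro rfl
    refine ⟨ℂ, inferInstance, inferInstance, inferInstance, 1, ?_, finrank_self ℂ⟩
    rw [Representation.isIrreducible_iff_forall_submodule]
    exact ⟨inferInstance, fun W _ => eq_bot_or_eq_top W⟩

/-- The group is the Heisenberg group over a prime field. -/
theorem exists_solvable_characterDegrees_eq_insert_one_prime (N : ℕ) :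
    ∃ p, p.Prime ∧ N < p ∧ ∃ (H : Type) (_ : Group H),
      Finite H ∧ Group.IsSolvable H ∧ characterDegrees H = {1, p} := by
  obtain ⟨p, hNp, hp⟩ := Nat.exists_infinite_primes (N + 1)
  have := Fact.mk hp
  refine ⟨p, hp, hNp, HeisenbergTorus (ZMod p) ⊥, inferInstance, inferInstance, inferInstance, ?_⟩
  rw [HeisenbergTorus.characterDegrees_eq, ZMod.card, Fintype.card_unique]
  ext
  simp
  tauto

/-- For primes `p ≡ 1` modulo `q`, the group is an extension of the Heisenberg group over `ZMod p` by
a subgroup of order `q` of `(ZMod p)ˣ`. -/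
theorem exists_solvable_characterDegrees_eq_insert_one_prime_pair (N : ℕ) :
    ∃ p q, p.Prime ∧ q.Prime ∧ N < q ∧ q < p ∧ ∃ (H : Type) (_ : Group H),
      Finite H ∧ Group.IsSolvable H ∧ characterDegrees H = {1, p, q} := by
  obtain ⟨q, hNq, hq⟩ := Nat.exists_infinite_primes (N + 1)
  obtain ⟨p, hp, hqp, hmod⟩ := Nat.exists_prime_gt_modEq_one q hq.ne_zero
  have := Fact.mk hp
  have := Fact.mk hq
  obtain ⟨g, hg⟩ := exists_prime_orderOf_dvd_card (G := (ZMod p)ˣ) q (by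
    rw [ZMod.card_units]
    exact (Nat.modEq_iff_dvd' hp.one_le).1 hmod.symm)
  refine ⟨p, q, hp, hq, hNq, hqp, HeisenbergTorus (ZMod p) (Subgroup.zpowers g), inferInstance,
    inferInstance, inferInstance, ?_⟩
  have := Fintype.ofFinite (Subgroup.zpowers g)
  rw [HeisenbergTorus.characterDegrees_eq, ZMod.card, ← Nat.card_eq_fintype_card,
    Nat.card_zpowers, hg]

section Cliques

open scoped Pointwise

variable {V : Type*} [DecidableEq V]

/-- The products of the labels `π v` over the cliques of `Γ` contained in `S`. -/
def cliqueProducts (Γ : SimpleGraph V) (S : Finset V) (π : V → ℕ) : Set ℕ :=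
  {d | ∃ K ⊆ S, Γ.IsClique (K : Set V) ∧ ∏ v ∈ K, π v = d}

omit [DecidableEq V] in
theorem cliqueProducts_congr (Γ : SimpleGraph V) {S : Finset V} {π σ : V → ℕ}
    (h : ∀ v ∈ S, π v = σ v) : cliqueProducts Γ S π = cliqueProducts Γ S σ := by
  ext d
  refine exists_congr fun K => and_congr_right fun hK => and_congr_right fun _ => ?_
  rw [Finset.prod_congr rfl fun v hv => h v (hK hv)]

/-- A clique in the join of `S` with an independent set `B` consists of a clique in `S` and at most
one vertex of `B`. -/
theorem cliqueProducts_union {Γ : SimpleGraph V} {S B : Finset V} (π : V → ℕ)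
    (hB : ∀ u ∈ B, ∀ v ∈ B, ¬ Γ.Adj u v) (hSB : ∀ u ∈ S, ∀ v ∈ B, Γ.Adj u v) :
    cliqueProducts Γ (S ∪ B) π = cliqueProducts Γ S π * insert 1 (π '' B) := by
  ext d
  rw [Set.mem_mul]
  constructor
  · rintro ⟨K, hK, hcl, rfl⟩
    by_cases hKB : ∃ b ∈ B, b ∈ K
    · obtain ⟨b, hb, hbK⟩ := hKB
      refine ⟨_, ⟨K.erase b, fun v hv => ?_, hcl.subset (by simp), rfl⟩, π b,
        Or.inr ⟨b, hb, rfl⟩, Finset.prod_erase_mul K π hbK⟩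
      obtain ⟨hvb, hvK⟩ := Finset.mem_erase.1 hv
      exact (Finset.mem_union.1 (hK hvK)).resolve_right fun hvB =>
        hB v hvB b hb (hcl hvK hbK hvb)
    · push Not at hKB
      exact ⟨_, ⟨K, fun v hv => (Finset.mem_union.1 (hK hv)).resolve_right fun hvB =>
        hKB v hvB hv, hcl, rfl⟩, 1, Or.inl rfl, mul_one _⟩
  · rintro ⟨_, ⟨K, hK, hcl, rfl⟩, e, rfl | ⟨b, hb, rfl⟩, rfl⟩
    · exact ⟨K, hK.trans Finset.subset_union_left, hcl, (mul_one _).symm⟩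
    · have hbK : b ∉ K := fun h => (hSB b (hK h) b hb).ne rfl
      refine ⟨insert b K, ?_, ?_, ?_⟩
      · exact Finset.insert_subset (Finset.mem_union_right _ hb)
          (hK.trans Finset.subset_union_left)
      · rw [Finset.coe_insert]
        exact hcl.insert fun v hv _ => (hSB v (hK hv) b hb).symm
      · rw [Finset.prod_insert hbK, mul_comm]

/-- A labelling of a vertex set `S` by distinct primes, together with a finite solvable group whose
character degrees are the products of the labels over the cliques in `S`. -/
def IsCliqueRealizable (Γ : SimpleGraph V) (S : Finset V) : Prop :=
  ∃ π : V → ℕ, (∀ v ∈ S, (π v).Prime) ∧ Set.InjOn π S ∧ ∃ (H : Type) (_ : Group H),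
    Finite H ∧ Group.IsSolvable H ∧ characterDegrees H = cliqueProducts Γ S π

/-- Joining an independent set `B` to `S` amounts to a direct product with a group that realizes
`B` by primes larger than those in use. -/
theorem IsCliqueRealizable.union {Γ : SimpleGraph V} {S B : Finset V}
    (hS : IsCliqueRealizable Γ S)
    (hB : ∀ u ∈ B, ∀ v ∈ B, ¬ Γ.Adj u v) (hSB : ∀ u ∈ S, ∀ v ∈ B, Γ.Adj u v)
    (hreal : ∀ N : ℕ, ∃ σ : V → ℕ, (∀ v ∈ B, (σ v).Prime ∧ N < σ v) ∧ Set.InjOn σ B ∧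
      ∃ (H : Type) (_ : Group H), Finite H ∧ Group.IsSolvable H ∧
        characterDegrees H = insert 1 (σ '' B)) :
    IsCliqueRealizable Γ (S ∪ B) := by
  obtain ⟨π, hπ, hinj, H, _, _, _, hH⟩ := hS
  obtain ⟨σ, hσ, hσinj, H', _, _, _, hH'⟩ := hreal (∑ v ∈ S, π v)
  have hlt : ∀ u ∈ S, ∀ v ∈ B, π u < σ v := fun u hu v hv =>
    (Finset.single_le_sum (fun _ _ => Nat.zero_le _) hu).trans_lt (hσ v hv).2
  have hdisj : ∀ v ∈ S, v ∉ B := fun v hv hvB => (hSB v hv v hvB).ne rfl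
  let τ : V → ℕ := fun v => if v ∈ B then σ v else π v
  have hτB : ∀ v ∈ B, τ v = σ v := fun v hv => if_pos hv
  have hτS : ∀ v ∈ S, τ v = π v := fun v hv => if_neg (hdisj v hv)
  refine ⟨τ, fun v hv => ?_, fun u hu v hv huv => ?_, H × H', inferInstance, inferInstance,
    inferInstance, ?_⟩
  · rcases Finset.mem_union.1 hv with hv | hv
    · rw [hτS v hv]; exact hπ v hv
    · rw [hτB v hv]; exact (hσ v hv).1
  · rcases Finset.mem_union.1 hu with hu | hu <;> rcases Finset.mem_union.1 hv with hv | hv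
    · rw [hτS u hu, hτS v hv] at huv; exact hinj hu hv huv
    · rw [hτS u hu, hτB v hv] at huv; exact absurd huv (hlt u hu v hv).ne
    · rw [hτB u hu, hτS v hv] at huv; exact absurd huv (hlt v hv u hu).ne'
    · rw [hτB u hu, hτB v hv] at huv; exact hσinj hu hv huv
  · rw [characterDegrees_prod, hH, hH', cliqueProducts_union τ hB hSB,
      cliqueProducts_congr Γ hτS, Set.image_congr (s := (B : Set V)) hτB]

/-- If every vertex has at most one non-neighbour besides itself, then `S` arises from the empty set
by repeatedly joining a single vertex or a pair of non-adjacent vertices. -/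
theorem isCliqueRealizable_of_nonadj_unique {Γ : SimpleGraph V}
    (hΓ : ∀ u v w, v ≠ u → w ≠ u → ¬ Γ.Adj u v → ¬ Γ.Adj u w → v = w) (S : Finset V) :
    IsCliqueRealizable Γ S := by
  induction S using Finset.strongInduction with
  | H S ih =>
    obtain rfl | ⟨v, hv⟩ := S.eq_empty_or_nonempty
    · refine ⟨fun _ => 0, by simp, by simp, Unit, inferInstance, inferInstance, inferInstance, ?_⟩
      rw [characterDegrees_unit]
      ext d
      simp [cliqueProducts, Finset.subset_empty, eq_comm]
    by_cases hw : ∃ w ∈ S, w ≠ v ∧ ¬ Γ.Adj v w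
    · obtain ⟨w, hwS, hwv, hadj⟩ := hw
      have hsub : {v, w} ⊆ S := by simp [Finset.insert_subset_iff, hv, hwS]
      rw [← Finset.sdiff_union_of_subset hsub]
      refine (ih (S \ {v, w}) (Finset.sdiff_ssubset hsub ⟨v, by simp⟩)).union ?_ ?_ fun N => ?_
      · simp [hadj, Γ.adj_comm w v]
      · intro u hu b hb
        simp only [Finset.mem_sdiff, Finset.mem_insert, Finset.mem_singleton, not_or] at hu hb
        by_contra hub
        rcases hb with rfl | rfl
        · exact hu.2.2 (hΓ b u w hu.2.1 hwv (fun h => hub h.symm) hadj)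
        · exact hu.2.1 (hΓ b u v hu.2.2 hwv.symm (fun h => hub h.symm) fun h => hadj h.symm)
      · obtain ⟨p, q, hp, hq, hNq, hqp, H, _, hfin, hsol, hH⟩ :=
          exists_solvable_characterDegrees_eq_insert_one_prime_pair N
        refine ⟨fun u => if u = v then p else q, fun u hu => ?_, ?_, H, _, hfin, hsol, ?_⟩
        · dsimp only
          split_ifs
          exacts [⟨hp, hNq.trans hqp⟩, ⟨hq, hNq⟩]
        · rw [Finset.coe_pair, Set.injOn_pair]
          simp [hwv, hqp.ne']
        · rw [hH, Finset.coe_pair, Set.image_pair]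
          simp [hwv]
    · push Not at hw
      have hsub : {v} ⊆ S := by simpa using hv
      rw [← Finset.sdiff_union_of_subset hsub]
      refine (ih (S \ {v}) (Finset.sdiff_ssubset hsub ⟨v, by simp⟩)).union ?_ ?_ fun N => ?_
      · simp
      · intro u hu b hb
        simp only [Finset.mem_sdiff, Finset.mem_singleton] at hu hb
        exact hb ▸ (hw u hu.1 hu.2).symm
      · obtain ⟨p, hp, hNp, H, _, hfin, hsol, hH⟩ :=
          exists_solvable_characterDegrees_eq_insert_one_prime N
        exact ⟨fun _ => p, fun _ _ => ⟨hp, hNp⟩, by simp, H, _, hfin, hsol, by simp [hH]⟩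

/-- By unique factorization, a product of labels over a clique is divisible by `π u * π v` only if `u`
and `v` lie in the clique. -/
theorem IsCliqueRealizable.isSolvableCharacterDegreeGraph [Fintype V] {Γ : SimpleGraph V}
    (h : IsCliqueRealizable Γ Finset.univ) : IsSolvableCharacterDegreeGraph Γ := by
  obtain ⟨π, hπ, hinj, H, _, hfin, hsol, hH⟩ := h
  replace hπ : ∀ v, (π v).Prime := fun v => hπ v (Finset.mem_univ v)
  rw [Finset.coe_univ, Set.injOn_univ] at hinj
  have hdvd : ∀ {p : ℕ} {K : Finset V}, p.Prime → p ∣ ∏ v ∈ K, π v → ∃ v ∈ K, π v = p :=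
    fun hp hpd => by
      obtain ⟨v, hv, hpv⟩ := (hp.prime.dvd_finsetProd_iff _).1 hpd
      exact ⟨v, hv, ((Nat.prime_dvd_prime_iff_eq hp (hπ v)).1 hpv).symm⟩
  have hmem : ∀ v, π v ∈ characterDegreePrimes H := fun v =>
    ⟨hπ v, π v, hH ▸ ⟨{v}, Finset.subset_univ _, by simp, by simp⟩, dvd_rfl⟩
  let e : V ≃ characterDegreePrimes H :=
    Equiv.ofBijective (fun v => ⟨π v, hmem v⟩) ⟨fun u v huv => hinj (congrArg Subtype.val huv), by
      rintro ⟨p, hp, d, hd, hpd⟩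
      rw [hH] at hd
      obtain ⟨K, -, -, rfl⟩ := hd
      obtain ⟨v, -, rfl⟩ := hdvd hp hpd
      exact ⟨v, rfl⟩⟩
  refine ⟨H, _, hfin, hsol, ⟨RelIso.symm ⟨e, fun {u v} => ?_⟩⟩⟩
  constructor
  · rintro ⟨hne, d, hd, huv⟩
    rw [hH] at hd
    obtain ⟨K, -, hK, rfl⟩ := hd
    obtain ⟨u', hu, hu'⟩ := hdvd (hπ u) ((dvd_mul_right _ _).trans huv)
    obtain ⟨v', hv, hv'⟩ := hdvd (hπ v) ((dvd_mul_left _ _).trans huv)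
    rw [hinj hu'] at hu
    rw [hinj hv'] at hv
    exact hK hu hv fun h => hne (congrArg e h)
  · intro huv
    refine ⟨fun h => huv.ne (e.injective h), π u * π v, ?_, dvd_rfl⟩
    rw [hH]
    refine ⟨{u, v}, Finset.subset_univ _, ?_, Finset.prod_pair huv.ne⟩
    rw [Finset.coe_pair, SimpleGraph.isClique_pair]
    exact fun _ => huv

end Cliques

theorem theorem3p1 (n : ℕ) (hn : 4 ≤ n) (hn_even : Even n)
    (G : Type*) [Group G] [Finite G] [Group.IsSolvable G]
    (hcard : Nat.card (characterDegreePrimes G) = n)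
    (hreg : ∀ p, ((characterDegreeGraph G).neighborSet p).ncard = n - 2)
    (Γ : SimpleGraph (characterDegreePrimes G)) (hΓ : characterDegreeGraph G ≤ Γ) :
    IsSolvableCharacterDegreeGraph Γ := by
  classical
  have : Finite (characterDegreePrimes G) := Nat.finite_of_card_ne_zero (by omega)
  have := Fintype.ofFinite (characterDegreePrimes G)
  refine (isCliqueRealizable_of_nonadj_unique (fun u v w hvu hwu hv hw => ?_)
    Finset.univ).isSolvableCharacterDegreeGraph
  -- Otherwise `u`, `v`, `w` are three distinct vertices outside the neighbourhood of `u`.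
  by_contra hvw
  have hsub : (characterDegreeGraph G).neighborSet u ⊆ ({u, v, w} : Set _)ᶜ := fun x hx => by
    simp only [Set.mem_compl_iff, Set.mem_insert_iff, Set.mem_singleton_iff, not_or]
    refine ⟨?_, ?_, ?_⟩
    · rintro rfl; exact hx.1 rfl
    · rintro rfl; exact hv (hΓ hx)
    · rintro rfl; exact hw (hΓ hx)
  have h1 := Set.ncard_le_ncard hsub
  have h2 := Set.ncard_add_ncard_compl ({u, v, w} : Set (characterDegreePrimes G))
  rw [Set.ncard_eq_three.2 ⟨u, v, w, hvu.symm, hwu.symm, hvw, rfl⟩] at h2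
  rw [hreg] at h1
  omega
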